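/- Let $l, n, d \ge 0$ be integers and let $g_1, \ldots, g_n \in \mathbb{C}[x_1, \ldots, x_l]$ be polynomials, not all zero, such that $$g_1^d + g_2^d + \cdots + g_n^d = 0,$$ where $p^0 = 1$ for every polynomial $p$. Suppose that $d \ge n(n-2)$. Call polynomials $p, q$ similar if $q = \lambda p$ for some $\lambda \in \mathbb{C}$ with $\lambda \ne 0$. Then the set $\{1, 2, \ldots, n\}$ can be partitioned into nonempty, pairwise disjoint subsets such that for each subset $I$ of the partition $$\sum_{i \in I} g_i^d = 0$$ and the polynomials $g_i$ with $i \in I$ are pairwise similar. -/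

import Mathlib

/-- Two polynomials over `ℂ` are similar if the second one is a nonzero constant multiple of
the first one. -/
def PolySimilar {l : ℕ} (p q : MvPolynomial (Fin l) ℂ) : Prop :=
  ∃ c : ℂ, c ≠ 0 ∧ q = MvPolynomial.C c * p

/-! Group the terms by similarity: each nonzero class contributes a constant times one `d`-th power,
so it suffices that `d`-th powers of nonzero, pairwise non-similar polynomials are independent
(`linearIndependent_pow_of_not_similar`). A generic line reduces this to one variable. There, take a
minimal relation with `m ≥ 3` terms, absorb its coefficients into the powers and remove common
factors. The Wronskians omitting one term agree up to sign, so they vanish everywhere to at least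
the order of `∏ g i ^ (d - (m - 2))` over all `m` terms. Comparing degrees with the term of largest
degree omitted forces `d < m * (m - 2)` (`fermat_degree_lt_of_no_common_zero`). -/

/-- The Wronskian matrix of a family of polynomials: the entry `(i, j)` is the `i`-th derivative of
the `j`-th polynomial. -/
noncomputable def wronskianMatrix {K ι : Type*} [Field K] (m : ℕ) (f : ι → Polynomial K) :
    Matrix (Fin m) ι (Polynomial K) :=
  Matrix.of fun i j => Polynomial.derivative^[(i : ℕ)] (f j)

/-! ### Wronskians and relations between powers in one variable -/

section Wronskian

open Polynomial

variable {K : Type*} [Field K]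

theorem wronskianMatrix_apply {ι : Type*} (m : ℕ) (f : ι → K[X]) (i : Fin m) (j : ι) :
    wronskianMatrix m f i j = derivative^[(i : ℕ)] (f j) := rfl

/-- A polynomial solution of a linear differential equation of order `r` is zero if its first `r`
derivatives vanish at a point where the leading coefficient of the equation does not vanish. -/
theorem eq_zero_of_linear_ode [CharZero K] {m : ℕ} (a : Fin m → K[X]) (r : Fin m) (α : K)
    (hα : (a r).eval α ≠ 0) (ha : ∀ i, r < i → a i = 0) (f : K[X])
    (hf : ∑ i, a i * derivative^[(i : ℕ)] f = 0)
    (h0 : ∀ i < (r : ℕ), (derivative^[i] f).eval α = 0) : f = 0 := by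
  by_contra hne
  set e := f.rootMultiplicity α with he
  have hdvd : (X - C α) ^ e ∣ f := pow_rootMultiplicity_dvd f α
  have hre : (r : ℕ) ≤ e := by
    rcases Nat.eq_zero_or_pos (r : ℕ) with h | h
    · omega
    · have := (lt_rootMultiplicity_iff_isRoot_iterate_derivative (t := α) (n := r - 1) hne).2
        (fun k hk => h0 k (by omega))
      omega
  have hlow : ∀ i ∈ Finset.univ.erase r,
      (X - C α) ^ (e - r + 1) ∣ a i * derivative^[(i : ℕ)] f := by
    intro i hi
    rcases lt_or_gt_of_ne (Finset.ne_of_mem_erase hi) with h | h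
    · have h' : (i : ℕ) < r := h
      exact ((pow_dvd_pow _ (by omega)).trans
        (pow_sub_dvd_iterate_derivative_of_pow_dvd (i : ℕ) hdvd)).mul_left _
    · simp [ha i h]
  have htop : (X - C α) ^ (e - r + 1) ∣ a r * derivative^[(r : ℕ)] f := by
    rw [← Finset.add_sum_erase _ _ (Finset.mem_univ r)] at hf
    rw [eq_neg_of_add_eq_zero_left hf]
    exact (Finset.dvd_sum hlow).neg_right
  have hcop : IsCoprime ((X - C α) ^ (e - r + 1)) (a r) := by
    refine IsCoprime.pow_left ?_
    refine ((irreducible_X_sub_C α).coprime_iff_not_dvd).2 ?_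
    rwa [dvd_iff_isRoot]
  -- Differentiating `e - r` more times shows that the `e`-th derivative vanishes at `α`, so the
  -- multiplicity exceeds `e`.
  have hder := pow_sub_dvd_iterate_derivative_of_pow_dvd (e - r) (hcop.dvd_of_dvd_mul_left htop)
  rw [← Function.iterate_add_apply, Nat.sub_add_cancel hre, Nat.add_sub_cancel_left, pow_one,
    dvd_iff_isRoot] at hder
  refine lt_irrefl e ((lt_rootMultiplicity_iff_isRoot_iterate_derivative hne).2 fun k hk => ?_)
  rcases hk.lt_or_eq with h | rfl
  · have := pow_sub_dvd_iterate_derivative_of_pow_dvd k hdvd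
    exact dvd_iff_isRoot.1 ((dvd_pow_self _ (by omega)).trans this)
  · exact hder

/-- A relation between the rows is a linear equation, of some order `r < m`, solved by every `f j`.
Vanishing of `r` derivatives at a point imposes only `r` conditions on `m` coefficients, so some
nontrivial combination satisfies them and is zero by uniqueness. -/
theorem det_wronskianMatrix_ne_zero [CharZero K] {m : ℕ} {f : Fin m → K[X]}
    (hf : LinearIndependent K f) : (wronskianMatrix m f).det ≠ 0 := by
  intro hdet
  obtain ⟨a, ha0, ha⟩ := Matrix.exists_vecMul_eq_zero_iff.2 hdet
  obtain ⟨r, hr, hmax⟩ : ∃ r, a r ≠ 0 ∧ ∀ i, r < i → a i = 0 := by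
    obtain ⟨i, hi⟩ := Function.ne_iff.1 ha0
    obtain ⟨r, hr, hmax⟩ := (Set.toFinite {i | a i ≠ 0}).exists_maximal ⟨i, hi⟩
    refine ⟨r, hr, fun i hi => ?_⟩
    by_contra h
    exact absurd (hmax (show i ∈ {i | a i ≠ 0} from h) hi.le) (not_le.2 hi)
  obtain ⟨α, hα⟩ : ∃ α, (a r).eval α ≠ 0 := by
    by_contra! h
    exact hr (Polynomial.funext fun x => by simp [h x])
  let Φ : (Fin m → K) →ₗ[K] (Fin (r : ℕ) → K) := LinearMap.pi fun i =>
    leval α ∘ₗ (derivative ^ (i : ℕ) : Module.End K K[X]) ∘ₗ Fintype.linearCombination K f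
  have hker : LinearMap.ker Φ ≠ ⊥ := Φ.ker_ne_bot_of_finrank_lt (by simp)
  obtain ⟨c, hc, hc0⟩ := Submodule.exists_mem_ne_zero_of_ne_bot hker
  refine hc0 (funext fun j => Fintype.linearIndependent_iff.1 hf c ?_ j)
  refine eq_zero_of_linear_ode a r α hα hmax _ ?_ fun i hi => ?_
  · have hcol : ∀ j, ∑ i, a i * derivative^[(i : ℕ)] (f j) = 0 := fun j => congrFun ha j
    simp_rw [iterate_derivative_sum, iterate_derivative_smul, Finset.mul_sum, mul_smul_comm]
    rw [Finset.sum_comm]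
    simp_rw [← Finset.smul_sum, hcol, smul_zero, Finset.sum_const_zero]
  · have := congrFun (LinearMap.mem_ker.1 hc) ⟨i, hi⟩
    simp only [Φ, LinearMap.pi_apply, LinearMap.comp_apply, Module.End.pow_apply,
      Fintype.linearCombination_apply] at this
    exact this

theorem natDegree_det_le {m : ℕ} (M : Matrix (Fin m) (Fin m) K[X]) (b : Fin m → ℕ)
    (hM : ∀ i j, (M i j).natDegree ≤ b j) : M.det.natDegree ≤ ∑ j, b j := by
  rw [Matrix.det_apply]
  refine natDegree_sum_le_of_forall_le _ _ fun σ _ => ?_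
  refine (natDegree_smul_le _ _).trans ((natDegree_prod_le _ _).trans ?_)
  exact Finset.sum_le_sum fun j _ => hM _ _

/-- Multiplying row `i` by `X ^ i` undoes the drop in degree caused by differentiation. -/
theorem natDegree_det_wronskianMatrix_add_le {m : ℕ} (f : Fin m → K[X])
    (hW : (wronskianMatrix m f).det ≠ 0) :
    ∑ i : Fin m, (i : ℕ) + (wronskianMatrix m f).det.natDegree ≤ ∑ j, (f j).natDegree := by
  have h := natDegree_det_le (Matrix.of fun i j : Fin m => X ^ (i : ℕ) * wronskianMatrix m f i j)
    (fun j => (f j).natDegree) fun i j => ?_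
  · rwa [Matrix.det_mul_column (fun i : Fin m => (X : K[X]) ^ (i : ℕ)), Finset.prod_pow_eq_pow_sum,
      natDegree_X_pow_mul _ hW, add_comm] at h
  · rw [Matrix.of_apply, wronskianMatrix_apply]
    by_cases h0 : derivative^[(i : ℕ)] (f j) = 0
    · simp [h0]
    · rw [natDegree_X_pow_mul _ h0]
      have h1 := natDegree_iterate_derivative (f j) i
      have h2 : ¬ (f j).natDegree < i := fun h => h0 (iterate_derivative_eq_zero h)
      omega

theorem prod_pow_dvd_det_wronskianMatrix {m : ℕ} (g : Fin m → K[X]) (d : ℕ) :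
    ∏ j, g j ^ (d - (m - 1)) ∣ (wronskianMatrix m fun j => g j ^ d).det := by
  rw [Matrix.det_apply]
  refine Finset.dvd_sum fun σ _ => ?_
  rw [Units.smul_def, zsmul_eq_mul]
  refine Dvd.dvd.mul_left ?_ _
  refine Finset.prod_dvd_prod_of_dvd _ _ fun j _ => ?_
  exact (pow_dvd_pow _ (by omega)).trans (pow_sub_dvd_iterate_derivative_pow _ _ _)

theorem natDegree_le_of_rootMultiplicity_le [IsAlgClosed K] {p q : K[X]}
    (h : ∀ α, p.rootMultiplicity α ≤ q.rootMultiplicity α) : p.natDegree ≤ q.natDegree := by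
  classical
  rw [(IsAlgClosed.splits p).natDegree_eq_card_roots, (IsAlgClosed.splits q).natDegree_eq_card_roots]
  exact Multiset.card_le_card (Multiset.le_iff_count.2 fun α => by simpa using h α)

/-- Case of `t + 3` powers without common zero such that the only linear relations among them are
the multiples of one relation in which no coefficient vanishes. -/
theorem fermat_degree_lt_of_no_common_zero [CharZero K] [IsAlgClosed K] {t d : ℕ}
    (g : Fin (t + 3) → K[X]) (hsum : ∑ i, g i ^ d = 0)
    (hind : LinearIndependent K fun j : Fin (t + 2) => g j.succ ^ d)
    (hcop : ∀ α, ∃ i, (g i).eval α ≠ 0) (h0 : ∀ i, g i ≠ 0) : d < (t + 3) * (t + 1) := by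
  by_contra! hd
  have hdt : t + 1 ≤ d := by nlinarith
  set W : Fin (t + 3) → K[X] := fun k =>
    (wronskianMatrix (t + 2) fun j => g (k.succAbove j) ^ d).det with hWdef
  have hassoc : ∀ k k', Associated (W k) (W k') := by
    intro k k'
    -- The columns sum to zero, so maximal minors agree up to sign.
    have h := Matrix.submatrix_succAbove_det_eq_negOnePow_submatrix_succAbove_det'
      (wronskianMatrix (t + 2) fun j => g j ^ d) (fun i => by
        simp_rw [wronskianMatrix_apply]
        rw [← iterate_derivative_sum, hsum, iterate_derivative_zero]) k k'
    change W k = _ • W k' at h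
    rw [h, Units.smul_def, zsmul_eq_mul]
    refine (associated_unit_mul_left _ _ ?_)
    exact (Units.isUnit _).map (Int.castRingHom K[X])
  have hW0 : ∀ k, W k ≠ 0 := fun k =>
    (hassoc 0 k).ne_zero_iff.1 (det_wronskianMatrix_ne_zero (by simpa using hind))
  have hprod : ∀ s : Finset (Fin (t + 3)), ∏ i ∈ s, g i ^ (d - (t + 1)) ≠ 0 := fun s =>
    Finset.prod_ne_zero_iff.2 fun i _ => pow_ne_zero _ (h0 i)
  have hlow : ∀ k, ∑ i, (d - (t + 1)) * (g i).natDegree ≤ (W k).natDegree := by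
    intro k
    have := natDegree_le_of_rootMultiplicity_le (p := ∏ i, g i ^ (d - (t + 1))) (q := W k) ?_
    · rw [natDegree_prod _ _ fun i _ => pow_ne_zero _ (h0 i)] at this
      simpa using this
    · intro α
      -- Omitting a term that does not vanish at `α` loses no multiplicity there.
      obtain ⟨k', hk'⟩ := hcop α
      rw [Fin.prod_univ_succAbove _ k', rootMultiplicity_mul
        (by rw [← Fin.prod_univ_succAbove (fun i => g i ^ (d - (t + 1))) k']; exact hprod _),
        rootMultiplicity_eq_zero (p := g k' ^ (d - (t + 1))) (by simp [hk']), zero_add]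
      rw [le_rootMultiplicity_iff (hW0 k)]
      refine (pow_rootMultiplicity_dvd _ _).trans ?_
      exact (prod_pow_dvd_det_wronskianMatrix (fun j => g (k'.succAbove j)) d).trans
        (hassoc k' k).dvd
  obtain ⟨k, -, hk⟩ := Finset.exists_max_image Finset.univ (fun i => (g i).natDegree)
    Finset.univ_nonempty
  have hup := natDegree_det_wronskianMatrix_add_le (fun j => g (k.succAbove j) ^ d) (hW0 k)
  -- This gain of at least one makes the final inequality strict.
  have hpos : 1 ≤ ∑ i : Fin (t + 2), (i : ℕ) :=
    Finset.single_le_sum (f := fun i : Fin (t + 2) => (i : ℕ)) (fun _ _ => Nat.zero_le _)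
      (Finset.mem_univ (1 : Fin (t + 2)))
  have hS : ∑ i, (g i).natDegree ≤ (t + 3) * (g k).natDegree := by
    simpa using Finset.sum_le_card_nsmul Finset.univ (fun i => (g i).natDegree) _ hk
  have hsplit := Fin.sum_univ_succAbove (fun i => (g i).natDegree) k
  have h1 := hlow k
  simp only [natDegree_pow] at hup
  rw [← Finset.mul_sum] at h1 hup
  change _ + (W k).natDegree ≤ _ at hup
  obtain ⟨e, rfl⟩ := Nat.exists_eq_add_of_le hdt
  rw [Nat.add_sub_cancel_left] at h1
  nlinarith [Nat.mul_le_mul_right (g k).natDegree hd, Nat.mul_le_mul_left (t + 1) hS]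

/-- Dividing a finite family of polynomials by a greatest common divisor. -/
theorem exists_eq_mul_no_common_zero {ι : Type*} [Fintype ι] (g : ι → K[X]) (h0 : ∃ i, g i ≠ 0) :
    ∃ (h : K[X]) (q : ι → K[X]), h ≠ 0 ∧ (∀ i, g i = h * q i) ∧ ∀ α, ∃ i, (q i).eval α ≠ 0 := by
  set I : Ideal K[X] := Ideal.span (Set.range g)
  set h := Submodule.IsPrincipal.generator I
  have hdvd : ∀ i, h ∣ g i := fun i =>
    (Submodule.IsPrincipal.mem_iff_generator_dvd I).1 (Ideal.subset_span ⟨i, rfl⟩)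
  choose q hq using hdvd
  have hh : h ≠ 0 := by
    rintro hh
    obtain ⟨i, hi⟩ := h0
    exact hi (by rw [hq i, hh, zero_mul])
  obtain ⟨a, ha⟩ := Ideal.mem_span_range_iff_exists_fun.1
    (Submodule.IsPrincipal.generator_mem I : h ∈ Ideal.span (Set.range g))
  refine ⟨h, q, hh, hq, fun α => ?_⟩
  by_contra! hα
  have h1 : ∑ i, a i * q i = 1 := by
    refine mul_left_cancel₀ hh ?_
    rw [mul_one, Finset.mul_sum]
    refine Eq.trans (Finset.sum_congr rfl fun i _ => ?_) ha
    rw [hq i]; ring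
  have h2 := congrArg (eval α) h1
  simp [eval_finsetSum, hα] at h2

theorem fermat_degree_lt [CharZero K] [IsAlgClosed K] {t d : ℕ}
    (g : Fin (t + 3) → K[X]) (hsum : ∑ i, g i ^ d = 0)
    (hind : LinearIndependent K fun j : Fin (t + 2) => g j.succ ^ d)
    (h0 : ∀ i, g i ≠ 0) : d < (t + 3) * (t + 1) := by
  obtain ⟨h, q, hh, hq, hcop⟩ := exists_eq_mul_no_common_zero g ⟨0, h0 0⟩
  refine fermat_degree_lt_of_no_common_zero q ?_ ?_ hcop fun i hi => h0 i (by rw [hq, hi, mul_zero])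
  · simp_rw [hq, mul_pow] at hsum
    rw [← Finset.mul_sum] at hsum
    exact (mul_eq_zero.1 hsum).resolve_left (pow_ne_zero _ hh)
  · refine LinearIndependent.of_comp (LinearMap.mulLeft K (h ^ d)) ?_
    have heq : (LinearMap.mulLeft K (h ^ d) ∘ fun j : Fin (t + 2) => q j.succ ^ d) =
        fun j => g j.succ ^ d := by
      ext1 j
      simp [hq, mul_pow]
    rw [heq]
    exact hind

theorem exists_eq_C_mul_of_pow_eq_pow [CharZero K] [IsAlgClosed K] {d : ℕ} (hd : 0 < d)
    {p q : K[X]} (h : p ^ d = q ^ d) : ∃ c : K, c ≠ 0 ∧ p = C c * q := by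
  have : NeZero d := ⟨hd.ne'⟩
  obtain ⟨ζ, hζ⟩ := HasEnoughRootsOfUnity.exists_primitiveRoot K d
  have hζ' : IsPrimitiveRoot (C ζ) d := hζ.map_of_injective (f := (C : K →+* K[X])) C_injective
  have := hζ'.pow_sub_pow_eq_prod_sub_mul p q hd
  rw [sub_eq_zero.2 h, eq_comm, Finset.prod_eq_zero_iff] at this
  obtain ⟨η, hη, hpq⟩ := this
  obtain ⟨i, -, rfl⟩ := hζ'.eq_pow_of_pow_eq_one ((mem_nthRootsFinset hd _).1 hη)
  exact ⟨ζ ^ i, pow_ne_zero _ (hζ.ne_zero hd.ne'), by rw [C_pow]; exact sub_eq_zero.1 hpq⟩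

theorem linearIndepOn_pow_of_not_similar [CharZero K] [IsAlgClosed K] {ι : Type*} {d : ℕ}
    (hd : 0 < d) (p : ι → K[X]) (h0 : ∀ i, p i ≠ 0)
    (hp : ∀ i j, i ≠ j → ∀ c : K, c ≠ 0 → p i ≠ C c * p j) (s : Finset ι)
    (hs : ∀ t, t + 3 ≤ s.card → (t + 3) * (t + 1) ≤ d) :
    LinearIndepOn K (fun i => p i ^ d) (s : Set ι) := by
  classical
  induction s using Finset.strongInduction with
  | H s ih =>
  rw [linearIndepOn_finset_iff]
  intro c hc
  by_contra! hne
  obtain ⟨i₀, hi₀, hci₀⟩ := hne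
  have ih' : ∀ i ∈ s, LinearIndepOn K (fun i => p i ^ d) ((s.erase i : Finset ι) : Set ι) :=
    fun i hi => ih _ (Finset.erase_ssubset hi) fun t ht =>
      hs t (ht.trans (Finset.card_le_card (Finset.erase_subset _ _)))
  have hc0 : ∀ i ∈ s, c i ≠ 0 := by
    intro i hi hci
    rw [← Finset.add_sum_erase _ _ hi, hci, zero_smul, zero_add] at hc
    have hne : i₀ ≠ i := fun h => hci₀ (h ▸ hci)
    exact hci₀ (linearIndepOn_finset_iff.1 (ih' i hi) c hc i₀ (Finset.mem_erase.2 ⟨hne, hi₀⟩))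
  -- A `d`-th root of each coefficient turns the relation into a plain sum of powers.
  choose b hb using fun i => IsAlgClosed.exists_pow_nat_eq (c i) hd
  have hb0 : ∀ i ∈ s, b i ≠ 0 := fun i hi h => hc0 i hi (by rw [← hb, h, zero_pow hd.ne'])
  have hterm : ∀ i, c i • p i ^ d = (C (b i) * p i) ^ d := fun i => by
    rw [mul_pow, ← C_pow, hb, smul_eq_C_mul]
  simp_rw [hterm] at hc
  set g : ι → K[X] := fun i => C (b i) * p i with hg
  have hg0 : ∀ i ∈ s, g i ≠ 0 := fun i hi => mul_ne_zero (C_ne_zero.2 (hb0 i hi)) (h0 i)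
  obtain ⟨n, hn⟩ : ∃ n, s.card = n + 1 :=
    Nat.exists_eq_succ_of_ne_zero (Finset.card_ne_zero_of_mem hi₀)
  rcases n with _ | _ | t
  · obtain ⟨i, rfl⟩ := Finset.card_eq_one.1 hn
    rw [Finset.sum_singleton] at hc
    exact pow_ne_zero _ (hg0 i (Finset.mem_singleton_self i)) hc
  · obtain ⟨i, j, hij, rfl⟩ := Finset.card_eq_two.1 hn
    rw [Finset.sum_pair hij] at hc
    obtain ⟨z, hz⟩ := IsAlgClosed.exists_pow_nat_eq (-1 : K) hd
    have hpow : g i ^ d = (C z * g j) ^ d := by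
      rw [mul_pow (C z), ← C_pow, hz, C_neg, C_1, neg_one_mul]
      exact eq_neg_of_add_eq_zero_left hc
    obtain ⟨u, hu, hgu⟩ := exists_eq_C_mul_of_pow_eq_pow hd hpow
    have hz0 : z ≠ 0 := by rintro rfl; simp [hd.ne'] at hz
    have hbi := hb0 i (by simp)
    have hbj := hb0 j (by simp)
    refine hp i j hij ((b i)⁻¹ * (u * (z * b j))) 
      (mul_ne_zero (inv_ne_zero hbi) (mul_ne_zero hu (mul_ne_zero hz0 hbj))) ?_
    refine mul_left_cancel₀ (C_ne_zero.2 hbi) ?_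
    rw [← mul_assoc, ← C_mul, mul_inv_cancel_left₀ hbi]
    simpa [hg, mul_assoc] using hgu
  · have e : Fin (t + 3) ≃ s := (s.equivFinOfCardEq hn).symm
    refine absurd (hs t hn.ge) (not_le.2 (fermat_degree_lt (fun k => g (e k)) ?_ ?_
      fun k => hg0 _ (e k).2))
    · rw [e.sum_comp (fun i : s => g i ^ d), Finset.sum_coe_sort s fun i => g i ^ d]
      exact hc
    · have hmem : ∀ k : Fin (t + 2), (e k.succ : ι) ∈ s.erase (e 0) := fun k =>
        Finset.mem_erase.2 ⟨fun h => Fin.succ_ne_zero k (e.injective (Subtype.ext h)), (e _).2⟩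
      have hli := (ih' (e 0) (e 0).2).linearIndependent.comp
        (fun k : Fin (t + 2) => (⟨e k.succ, hmem k⟩ : ((s.erase (e 0) : Finset ι) : Set ι)))
        (fun k k' h => Fin.succ_injective _ (e.injective (Subtype.ext (Subtype.mk.inj h))))
      convert hli.units_smul fun k => Units.mk0 (c (e k.succ)) (hc0 _ (e _).2) using 2 with k
      exact (hterm _).symm

end Wronskian

/-! ### Restriction to a generic line -/

section Specialization

open MvPolynomial

theorem exists_forall_eval_ne_zero {K σ ι : Type*} [Field K] [Infinite K] (s : Finset ι)
    (p : ι → MvPolynomial σ K) (hp : ∀ i ∈ s, p i ≠ 0) : ∃ a : σ → K, ∀ i ∈ s, eval a (p i) ≠ 0 := by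
  by_contra! h
  refine Finset.prod_ne_zero_iff.2 hp (MvPolynomial.funext fun a => ?_)
  obtain ⟨i, hi, ha⟩ := h a
  rw [map_prod, map_zero, Finset.prod_eq_zero hi ha]

/-- Pairwise non-similar polynomials stay pairwise non-similar on a suitable line. -/
theorem exists_line_not_similar {K σ ι : Type*} [Field K] [Infinite K] [Finite ι]
    (g : ι → MvPolynomial σ K) (h0 : ∀ i, g i ≠ 0)
    (hg : ∀ i j, i ≠ j → ∀ c : K, c ≠ 0 → g i ≠ C c * g j) :
    ∃ φ : MvPolynomial σ K →ₐ[K] Polynomial K, (∀ i, φ (g i) ≠ 0) ∧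
      ∀ i j, i ≠ j → ∀ c : K, c ≠ 0 → φ (g i) ≠ Polynomial.C c * φ (g j) := by
  classical
  have := Fintype.ofFinite ι
  obtain ⟨b, hb⟩ := exists_forall_eval_ne_zero Finset.univ g fun i _ => h0 i
  replace hb := fun i => hb i (Finset.mem_univ i)
  -- The line will join `b` to `a`; similarity on it would give equal ratios `g i : g j` at both
  -- points, which this choice excludes.
  obtain ⟨a, ha⟩ := exists_forall_eval_ne_zero (Finset.univ.filter fun x : ι × ι => x.1 ≠ x.2)
    (fun x => C (eval b (g x.2)) * g x.1 - C (eval b (g x.1)) * g x.2) (by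
      rintro ⟨i, j⟩ hij h
      rw [Finset.mem_filter] at hij
      refine hg i j hij.2 ((eval b (g j))⁻¹ * eval b (g i))
        (mul_ne_zero (inv_ne_zero (hb j)) (hb i)) ?_
      rw [C_mul, mul_assoc, ← sub_eq_zero.1 h, ← mul_assoc, ← C_mul, inv_mul_cancel₀ (hb j),
        C_1, one_mul])
  let φ : MvPolynomial σ K →ₐ[K] Polynomial K :=
    aeval fun k => Polynomial.C (b k) + Polynomial.X * Polynomial.C (a k - b k)
  have hφ : ∀ t p, (φ p).eval t = eval (fun k => b k + t * (a k - b k)) p := by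
    intro t p
    induction p using MvPolynomial.induction_on with
    | C c => simp [φ, ← MvPolynomial.algebraMap_eq]
    | add p q hp hq => simp [hp, hq]
    | mul_X p k hp => rw [map_mul, Polynomial.eval_mul, hp]; simp [φ]
  have hφ0 : ∀ p, (φ p).eval 0 = eval b p := fun p => by simp [hφ]
  have hφ1 : ∀ p, (φ p).eval 1 = eval a p := fun p => by simp [hφ]
  refine ⟨φ, fun i h => hb i (by rw [← hφ0, h, Polynomial.eval_zero]), fun i j hij c _ h => ?_⟩
  have e0 := congrArg (Polynomial.eval 0) h
  have e1 := congrArg (Polynomial.eval 1) h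
  simp only [Polynomial.eval_mul, Polynomial.eval_C, hφ0, hφ1] at e0 e1
  refine ha (i, j) (by simpa using hij) ?_
  simp only [map_sub, map_mul, eval_C, e0, e1]
  ring

/-- If `d` is large, the `d`-th powers of pairwise non-similar polynomials are linearly
independent. -/
theorem linearIndependent_pow_of_not_similar {K σ ι : Type*} [Field K] [CharZero K]
    [IsAlgClosed K] [Fintype ι] {d : ℕ} (hd : 0 < d) (g : ι → MvPolynomial σ K)
    (h0 : ∀ i, g i ≠ 0) (hg : ∀ i j, i ≠ j → ∀ c : K, c ≠ 0 → g i ≠ C c * g j)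
    (hι : ∀ t, t + 3 ≤ Fintype.card ι → (t + 3) * (t + 1) ≤ d) :
    LinearIndependent K fun i => g i ^ d := by
  obtain ⟨φ, hφ0, hφ⟩ := exists_line_not_similar g h0 hg
  have h := linearIndepOn_pow_of_not_similar hd (fun i => φ (g i)) hφ0 hφ Finset.univ hι
  rw [Finset.coe_univ, linearIndepOn_univ_iff] at h
  refine LinearIndependent.of_comp φ.toLinearMap ?_
  simpa [Function.comp_def] using h

end Specialization

/-- Similarity as an equivalence relation on the indices of a family. -/
def similarSetoid {l : ℕ} {ι : Type*} (g : ι → MvPolynomial (Fin l) ℂ) : Setoid ι where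
  r i j := PolySimilar (g i) (g j)
  iseqv :=
    { refl := fun i => ⟨1, one_ne_zero, by simp⟩
      symm := by
        rintro i j ⟨c, hc, h⟩
        refine ⟨c⁻¹, inv_ne_zero hc, ?_⟩
        rw [h, ← mul_assoc, ← MvPolynomial.C_mul, inv_mul_cancel₀ hc, MvPolynomial.C_1, one_mul]
      trans := by
        rintro i j k ⟨c, hc, h⟩ ⟨c', hc', h'⟩
        exact ⟨c' * c, mul_ne_zero hc' hc, by rw [h', h, ← mul_assoc, MvPolynomial.C_mul]⟩ }

theorem sum_pow_similar_class_eq_zero {l d : ℕ} {ι : Type*} [Fintype ι]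
    (g : ι → MvPolynomial (Fin l) ℂ) (hsum : ∑ i, g i ^ d = 0) (hd : 0 < d)
    (hι : ∀ t, t + 3 ≤ Fintype.card ι → (t + 3) * (t + 1) ≤ d) (I : Finset ι) (i₀ : ι)
    (hI : ∀ i, i ∈ I ↔ PolySimilar (g i₀) (g i)) : ∑ i ∈ I, g i ^ d = 0 := by
  classical
  let S := similarSetoid g
  by_cases h0 : g i₀ = 0
  · refine Finset.sum_eq_zero fun i hi => ?_
    obtain ⟨c, -, h⟩ := (hI i).1 hi
    rw [h, h0, mul_zero, zero_pow hd.ne']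
  have hrep : ∀ i, PolySimilar (g (Quotient.mk S i).out) (g i) := fun i => Quotient.mk_out i
  choose c _ hc using hrep
  -- The class of the zero polynomial would break independence.
  let Q := {q : Quotient S // g q.out ≠ 0}
  have hli : LinearIndependent ℂ fun q : Q => g q.1.out ^ d := by
    refine linearIndependent_pow_of_not_similar hd (fun q : Q => g q.1.out) (fun q => q.2) ?_
      fun t ht => hι t (ht.trans ?_)
    · intro q q' hq a ha h
      refine hq (Subtype.ext ?_)
      rw [← Quotient.out_eq q.1, ← Quotient.out_eq q'.1]
      exact (Quotient.sound (s := S) ⟨a, ha, h⟩).symm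
    · exact (Fintype.card_subtype_le _).trans (Fintype.card_quotient_le S)
  have hclass : ∀ q : Quotient S, ∑ i with Quotient.mk S i = q, g i ^ d =
      (∑ i with Quotient.mk S i = q, c i ^ d) • g q.out ^ d := by
    intro q
    rw [Finset.sum_smul]
    refine Finset.sum_congr rfl fun i hi => ?_
    obtain rfl := (Finset.mem_filter.1 hi).2
    conv_lhs => rw [hc i]
    rw [mul_pow, ← MvPolynomial.C_pow, MvPolynomial.smul_eq_C_mul]
  have htotal : ∑ q : Q, (∑ i with Quotient.mk S i = q.1, c i ^ d) • g q.1.out ^ d = 0 := by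
    rw [← Finset.sum_fiberwise Finset.univ (Quotient.mk S)] at hsum
    simp_rw [hclass] at hsum
    refine Eq.trans ?_ hsum
    rw [← Finset.sum_filter_of_ne (p := fun q : Quotient S => g q.out ≠ 0)]
    · exact (Finset.sum_subtype (p := fun q : Quotient S => g q.out ≠ 0) _ (fun q => by
        rw [Finset.mem_filter, and_iff_right (Finset.mem_univ q)]) fun q =>
          (∑ i with Quotient.mk S i = q, c i ^ d) • g q.out ^ d).symm
    · intro q _ hq h
      exact hq (by rw [h, zero_pow hd.ne', smul_zero])
  have hi₀ : g (Quotient.mk S i₀).out ≠ 0 := fun h => h0 (by rw [hc i₀, h, mul_zero])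
  have hzero := Fintype.linearIndependent_iff.1 hli _ htotal ⟨Quotient.mk S i₀, hi₀⟩
  have hIq : I = Finset.univ.filter fun i => Quotient.mk S i = Quotient.mk S i₀ := by
    ext i
    rw [hI, Finset.mem_filter, Quotient.eq (r := S)]
    exact ⟨fun h => ⟨Finset.mem_univ _, S.symm h⟩, fun h => S.symm h.2⟩
  rw [hIq, hclass, hzero, zero_smul]

theorem mainTheorem7 (l n d : ℕ) (g : Fin n → MvPolynomial (Fin l) ℂ)
    (hsum : ∑ i, g i ^ d = 0) (hne : ∃ i, g i ≠ 0)
    (hd : (n : ℤ) * ((n : ℤ) - 2) ≤ (d : ℤ)) :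
    ∃ P : Finpartition (Finset.univ : Finset (Fin n)),
      ∀ I ∈ P.parts, ∑ i ∈ I, g i ^ d = 0 ∧ ∀ i ∈ I, ∀ j ∈ I, PolySimilar (g i) (g j) := by
  classical
  obtain ⟨k, -⟩ := hne
  -- For `d = 0` the sum would be the nonzero constant `n`.
  have hd0 : 0 < d := by
    refine Nat.pos_of_ne_zero fun h => ?_
    subst h
    simp only [pow_zero, Finset.sum_const, Finset.card_univ, Fintype.card_fin, nsmul_one,
      Nat.cast_eq_zero] at hsum
    exact (Fin.pos k).ne' hsum
  have hn : ∀ t, t + 3 ≤ Fintype.card (Fin n) → (t + 3) * (t + 1) ≤ d := by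
    intro t ht
    rw [Fintype.card_fin] at ht
    obtain ⟨e, rfl⟩ := Nat.exists_eq_add_of_le ht
    push_cast at hd
    zify
    nlinarith
  let S := similarSetoid g
  refine ⟨Finpartition.ofSetoid S, fun I hI => ?_⟩
  obtain ⟨i₀, hi₀⟩ := (Finpartition.ofSetoid S).nonempty_of_mem_parts hI
  have hmem : ∀ i, i ∈ I ↔ PolySimilar (g i₀) (g i) := by
    intro i
    rw [← (Finpartition.ofSetoid S).part_eq_of_mem hI hi₀]
    exact Finpartition.mem_part_ofSetoid_iff_rel
  refine ⟨sum_pow_similar_class_eq_zero g hsum hd0 hn I i₀ hmem, fun i hi j hj => ?_⟩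
  exact S.trans (S.symm ((hmem i).1 hi)) ((hmem j).1 hj)
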